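/- **Theorem 3.1.** Let $\mathbb T$ be the set of isomorphism classes of finite non-empty rooted trees. For $t\in\mathbb T$ let $V(t)$, $E(t)$ be its sets of vertices and edges and $|t|=\#V(t)$. For $s,t\in\mathbb T$ and $v\in V(s)$ let $s\cup_v t$ be the rooted tree obtained by joining the root of $t$ to $v$ by a single edge. For $e\in E(t)$, removing $e$ splits $t$ into the rooted tree $R_e(t)$ containing the root of $t$ and the remaining component $P_e(t)$, rooted at the endpoint of $e$ in it. For $r,p,u\in\mathbb T$ put $$c(r,p;u)=\#\{e\in E(u)\mid R_e(u)=r,\ P_e(u)=p\},\qquad n(r,p;u)=\#\{v\in V(r)\mid r\cup_v p=u\}.$$ The insertion-elimination Lie algebra $\mathfrak g$ is the complex Lie algebra with generators $D^+_t$, $D^-_t$ ($t\in\mathbb T$) and $d$, and relations $$[D^+_{t_1},D^+_{t_2}]=\sum_{v\in V(t_2)}D^+_{t_2\cup_v t_1}-\sum_{v\in V(t_1)}D^+_{t_1\cup_v t_2},$$ $$[D^-_{t_1},D^-_{t_2}]=\sum_{t\in\mathbb T}c(t_1,t_2;t)\,D^-_t-\sum_{t\in\mathbb T}c(t_2,t_1;t)\,D^-_t,$$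 $$[D^-_{t_1},D^+_{t_2}]=\sum_{t\in\mathbb T}c(t,t_1;t_2)\,D^+_t+\sum_{t\in\mathbb T}n(t,t_2;t_1)\,D^-_t\qquad(t_1\neq t_2),$$ $$[D^-_t,D^+_t]=d,\qquad [d,D^-_t]=-|t|\,D^-_t,\qquad [d,D^+_t]=|t|\,D^+_t,$$ for all $t_1,t_2,t\in\mathbb T$ (all sums are finite). Let $\mathfrak n_\pm\subset\mathfrak g$ be the Lie subalgebra generated by the $D^\pm_t$, $t\in\mathbb T$. Then: 1. $\mathfrak g$ is a simple Lie algebra (it is non-abelian and its only ideals are $0$ and $\mathfrak g$). 2. $\mathfrak g$ is generated as a Lie algebra by the $D^\pm_t$ ($t\in\mathbb T$) and $d$. 3. $\mathfrak g=\mathfrak n_+\oplus\mathbb C d\oplus\mathfrak n_-$ as vector spaces. 4. $\mathfrak g$ is the Lie algebra of insertion and elimination operators on rooted trees: there is a faithful representation of $\mathfrak g$ on the complex vector space with basis $\mathbb T$ such that, for $s,t\in\mathbb T$, $$D^+_t(s)=\sum_{v\in V(s)}s\cup_v t,\qquad D^-_t(s)=\sum_{e\in E(s),\ P_e(s)=t}R_e(s),\qquad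 d(s)=|s|\,s.$$ -/

import Mathlib

namespace InsertionElimination

/-! ### Rooted trees -/

/-- Finite rooted trees in which the children of every vertex are listed in some order. -/
inductive OTree : Type
  | node (children : List OTree) : OTree

namespace OTree

/-- Isomorphism of rooted trees: two ordered trees give the same rooted tree if one is obtained
from the other by reordering the children of vertices. (`perm` reorders the children of the root;
`cons` replaces the first child of the root by an isomorphic one, and together with `perm` and
`trans` any child.) -/
inductive Iso : OTree → OTree → Prop
  | perm {l l' : List OTree} : l.Perm l' → Iso (node l) (node l')
  | cons {s s' : OTree} (l : List OTree) : Iso s s' → Iso (node (s :: l)) (node (s' :: l))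
  | trans {s t u : OTree} : Iso s t → Iso t u → Iso s u

mutual
/-- The number of vertices. -/
def size : OTree → ℕ
  | node l => 1 + sizeList l
/-- The number of vertices of a list of trees. -/
def sizeList : List OTree → ℕ
  | [] => 0
  | s :: l => size s + sizeList l
end

mutual
/-- `graft t s` lists, for the vertices `v` of `s`, the trees obtained from `s` by joining the root
of `t` to `v` by a new edge. The first entry belongs to the root of `s`. -/
def graft (t : OTree) : OTree → List OTree
  | node l => node (t :: l) :: (graftList t l).map node
/-- The same for the vertices `v` of a list of trees. -/
def graftList (t : OTree) : List OTree → List (List OTree)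
  | [] => []
  | s :: l => (graft t s).map (fun x => x :: l) ++ (graftList t l).map (fun m => s :: m)
end

mutual
/-- `cuts u` lists, for the edges `e` of `u`, the pairs `(P, R)` of the two components of `u` after
removal of `e`, where `R` is the component that contains the root of `u`. -/
def cuts : OTree → List (OTree × OTree)
  | node l => (cutsList l).map (fun x => (x.1, node x.2))
/-- The same for the edges above the roots in a list of trees (which become edges from a common
parent) and for the edges inside these trees. -/
def cutsList : List OTree → List (OTree × List OTree)
  | [] => []
  | s :: l => (s, l) :: ((cuts s).map (fun x => (x.1, x.2 :: l)) ++
      (cutsList l).map (fun x => (x.1, s :: x.2)))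
end

theorem Iso.refl : ∀ t : OTree, Iso t t
  | node l => Iso.perm (List.Perm.refl l)

theorem Iso.symm {s t : OTree} (h : Iso s t) : Iso t s := by
  induction h with
  | perm h => exact Iso.perm h.symm
  | cons l _ ih => exact Iso.cons l ih
  | trans _ _ ih₁ ih₂ => exact Iso.trans ih₂ ih₁

instance setoid : Setoid OTree where
  r := Iso
  iseqv := ⟨Iso.refl, Iso.symm, Iso.trans⟩

end OTree

/-- The set of (non-empty, finite) rooted trees up to isomorphism. -/
def RTree : Type := Quotient OTree.setoid

noncomputable instance : DecidableEq RTree := Classical.decEq _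

namespace OTree

/-- The rooted tree underlying an ordered tree. -/
def toRooted (t : OTree) : RTree := Quotient.mk setoid t

theorem toRooted_eq {s t : OTree} (h : Iso s t) : s.toRooted = t.toRooted := Quotient.sound h

theorem Iso.cons_of_perm {s s' : OTree} {l l' : List OTree} (h : Iso s s') (hl : l.Perm l') :
    Iso (node (s :: l)) (node (s' :: l')) :=
  (Iso.cons l h).trans (Iso.perm (hl.cons s'))

theorem Iso.tail (s : OTree) {l l' : List OTree} (h : Iso (node l) (node l')) :
    Iso (node (s :: l)) (node (s :: l')) := by
  have aux : ∀ {x y : OTree}, Iso x y → ∀ m m', x = node m → y = node m' →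
      Iso (node (s :: m)) (node (s :: m')) := by
    intro x y h
    induction h with
    | perm h => rintro m m' ⟨⟩ ⟨⟩; exact Iso.perm (h.cons s)
    | @cons a a' l h _ =>
      rintro m m' ⟨⟩ ⟨⟩
      exact (Iso.perm (List.Perm.swap a s l)).trans
        ((Iso.cons (s :: l) h).trans (Iso.perm (List.Perm.swap s a' l)))
    | @trans a b c _ _ ih₁ ih₂ =>
      rintro m m' rfl rfl
      obtain ⟨k⟩ := b
      exact (ih₁ m k rfl rfl).trans (ih₂ k m' rfl rfl)
  exact aux h _ _ rfl rfl

theorem sizeList_perm {l l' : List OTree} (h : l.Perm l') : sizeList l = sizeList l' := by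
  induction h with
  | nil => rfl
  | cons a _ ih => simp [sizeList, ih]
  | swap a b l => simp only [sizeList]; omega
  | trans _ _ ih₁ ih₂ => exact ih₁.trans ih₂

theorem size_iso {s t : OTree} (h : Iso s t) : size s = size t := by
  induction h with
  | perm h => simp [size, sizeList_perm h]
  | cons l _ ih => simp [size, sizeList, ih]
  | trans _ _ ih₁ ih₂ => exact ih₁.trans ih₂

/-- The rooted tree whose root has the given multiset of children. -/
def nodeM (m : Multiset OTree) : RTree :=
  Quot.lift (fun l => (node l).toRooted) (fun _ _ h => toRooted_eq (Iso.perm h)) m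

/-- Joining a rooted tree as a new first child. -/
def consR (l : List OTree) (x : RTree) : RTree :=
  Quotient.lift (fun s => (node (s :: l)).toRooted)
    (fun _ _ h => toRooted_eq (Iso.cons l h)) x

theorem graftList_perm (t : OTree) {l l' : List OTree} (h : l.Perm l') :
    (graftList t l : Multiset (List OTree)).map (fun m : List OTree => (m : Multiset OTree)) =
      (graftList t l' : Multiset (List OTree)).map (fun m : List OTree => (m : Multiset OTree)) := by
  induction h with
  | nil => rfl
  | @cons a l l' hl ih =>
    have e : (l : Multiset OTree) = l' := Quot.sound hl
    have ih' := congrArg (Multiset.map (fun m => a ::ₘ m)) ih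
    simp only [Multiset.map_map, Function.comp_def, Multiset.cons_coe] at ih'
    simp only [graftList, ← Multiset.coe_add, ← Multiset.map_coe, Multiset.map_add,
      Multiset.map_map, Function.comp_def, ← Multiset.cons_coe, e] at ih' ⊢
    rw [ih']
  | swap a b l =>
    simp only [graftList, ← Multiset.coe_add, ← Multiset.map_coe, Multiset.map_add,
      Multiset.map_map, Function.comp_def, ← Multiset.cons_coe]
    rw [← add_assoc, ← add_assoc]
    refine congrArg₂ _ ((add_comm _ _).trans (congrArg₂ _ ?_ ?_)) ?_ <;>
      exact Multiset.map_congr rfl (fun x _ => Multiset.cons_swap _ _ _)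
  | trans _ _ ih₁ ih₂ => exact ih₁.trans ih₂

theorem graft_iso_right (t : OTree) {s s' : OTree} (h : Iso s s') :
    (graft t s : Multiset OTree).map toRooted = (graft t s' : Multiset OTree).map toRooted := by
  induction h with
  | @perm l l' hl =>
    have h₁ := congrArg (Multiset.map nodeM) (graftList_perm t hl)
    simp only [Multiset.map_map, Function.comp_def] at h₁
    simp only [graft, ← Multiset.cons_coe, ← Multiset.map_coe, Multiset.map_cons,
      Multiset.map_map, Function.comp_def]
    exact congrArg₂ _ (toRooted_eq (Iso.perm (hl.cons t))) h₁
  | @cons s s' l h ih =>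
    have h₁ := congrArg (Multiset.map (consR l)) ih
    simp only [Multiset.map_map, Function.comp_def] at h₁
    simp only [graft, graftList, ← Multiset.cons_coe, ← Multiset.map_coe, Multiset.map_cons,
      ← Multiset.coe_add, Multiset.map_add, Multiset.map_map, Function.comp_def]
    refine congrArg₂ _ (toRooted_eq (Iso.tail t (Iso.cons l h))) (congrArg₂ _ h₁ ?_)
    exact Multiset.map_congr rfl (fun m _ => toRooted_eq (Iso.cons m h))
  | trans _ _ ih₁ ih₂ => exact ih₁.trans ih₂

mutual
theorem graft_iso_left {t t' : OTree} (h : Iso t t') :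
    ∀ s : OTree, List.Forall₂ Iso (graft t s) (graft t' s)
  | node l => by
    simp only [graft]
    refine List.Forall₂.cons (Iso.cons l h) ?_
    simpa [List.forall₂_map_left_iff, List.forall₂_map_right_iff] using graftList_iso_left h l
theorem graftList_iso_left {t t' : OTree} (h : Iso t t') :
    ∀ l : List OTree,
      List.Forall₂ (fun m m' => Iso (node m) (node m')) (graftList t l) (graftList t' l)
  | [] => by simp [graftList]
  | s :: l => by
    simp only [graftList]
    refine List.rel_append ?_ ?_
    · rw [List.forall₂_map_left_iff, List.forall₂_map_right_iff]
      exact (graft_iso_left h s).imp (fun _ _ h => Iso.cons l h)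
    · rw [List.forall₂_map_left_iff, List.forall₂_map_right_iff]
      exact (graftList_iso_left h l).imp (fun _ _ h => Iso.tail s h)
end

theorem graft_iso {t t' s s' : OTree} (ht : Iso t t') (hs : Iso s s') :
    (graft t s : Multiset OTree).map toRooted = (graft t' s' : Multiset OTree).map toRooted := by
  rw [graft_iso_right t hs, Multiset.map_coe, Multiset.map_coe]
  refine congrArg _ ?_
  have h := graft_iso_left ht s'
  generalize graft t s' = a at h
  generalize graft t' s' = b at h
  induction h with
  | nil => rfl
  | cons h _ ih => simp only [List.map_cons, ih, toRooted_eq h]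

theorem cutsList_perm {l l' : List OTree} (h : l.Perm l') :
    ((cutsList l : Multiset (OTree × List OTree)).map
        (fun x => (x.1, (x.2 : Multiset OTree)))) =
      (cutsList l' : Multiset (OTree × List OTree)).map
        (fun x => (x.1, (x.2 : Multiset OTree))) := by
  induction h with
  | nil => rfl
  | @cons a l l' hl ih =>
    have e : (l : Multiset OTree) = l' := Quot.sound hl
    have ih' := congrArg (Multiset.map (fun x => (x.1, a ::ₘ x.2))) ih
    simp only [Multiset.map_map, Function.comp_def] at ih'
    simp only [cutsList, ← Multiset.coe_add, ← Multiset.map_coe, Multiset.map_add,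
      Multiset.map_map, Function.comp_def, ← Multiset.cons_coe, e, Multiset.map_cons] at ih' ⊢
    rw [ih']
  | swap a b l =>
    simp only [cutsList, ← Multiset.coe_add, ← Multiset.map_coe, Multiset.map_add,
      Multiset.map_map, Function.comp_def, ← Multiset.cons_coe, Multiset.map_cons]
    simp only [← Multiset.singleton_add]
    abel_nf
  | trans _ _ ih₁ ih₂ => exact ih₁.trans ih₂

theorem cuts_iso {s s' : OTree} (h : Iso s s') :
    (cuts s : Multiset (OTree × OTree)).map (Prod.map toRooted toRooted) =
      (cuts s' : Multiset (OTree × OTree)).map (Prod.map toRooted toRooted) := by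
  induction h with
  | @perm l l' hl =>
    have h₁ := congrArg (Multiset.map (fun x => (toRooted x.1, nodeM x.2))) (cutsList_perm hl)
    simp only [Multiset.map_map, Function.comp_def] at h₁
    simp only [cuts, ← Multiset.map_coe, Multiset.map_map, Function.comp_def]
    exact h₁
  | @cons s s' l h ih =>
    have h₁ := congrArg (Multiset.map (fun x => (x.1, consR l x.2))) ih
    simp only [Multiset.map_map, Function.comp_def] at h₁
    simp only [cuts, cutsList, ← Multiset.cons_coe, ← Multiset.map_coe, Multiset.map_cons,
      ← Multiset.coe_add, Multiset.map_add, Multiset.map_map, Function.comp_def]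
    refine congrArg₂ _ (Prod.ext (toRooted_eq h) rfl) (congrArg₂ _ h₁ ?_)
    exact Multiset.map_congr rfl (fun m _ => Prod.ext rfl (toRooted_eq (Iso.cons m.2 h)))
  | trans _ _ ih₁ ih₂ => exact ih₁.trans ih₂

end OTree

namespace RTree

/-- `|t|`, the number of vertices of `t`. -/
def numVertices (t : RTree) : ℕ :=
  Quotient.lift OTree.size (fun _ _ h => OTree.size_iso h) t

/-- The multiset of the rooted trees `s ∪_v t`, one for each vertex `v` of `s`, where `s ∪_v t` is
obtained by joining the root of `t` to the vertex `v` of `s` by a single edge. -/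
def graft (s t : RTree) : Multiset RTree :=
  Quotient.lift₂ (fun s t : OTree => (OTree.graft t s : Multiset OTree).map OTree.toRooted)
    (fun _ _ _ _ hs ht => OTree.graft_iso ht hs) s t

/-- The multiset of the pairs `(P_e(u), R_e(u))`, one for each edge `e` of `u`, where `R_e(u)` and
`P_e(u)` are the components of `u` without the edge `e` that contain, respectively do not contain,
the root of `u`. -/
def cuts (u : RTree) : Multiset (RTree × RTree) :=
  Quotient.lift (fun u : OTree =>
      (OTree.cuts u : Multiset (OTree × OTree)).map (Prod.map OTree.toRooted OTree.toRooted))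
    (fun _ _ h => OTree.cuts_iso h) u

/-- The number of edges `e` of `u` with `R_e(u) = r` and `P_e(u) = p`. -/
noncomputable def numCuts (r p u : RTree) : ℕ := (cuts u).count (p, r)

/-- The number of vertices `v` of `r` with `r ∪_v p = u`. -/
noncomputable def numGrafts (r p u : RTree) : ℕ := (graft r p).count u

end RTree

namespace OTree

mutual
theorem mem_cuts_of_mem_graft (t : OTree) :
    ∀ (s : OTree), ∀ u ∈ graft t s, (t, s) ∈ cuts u
  | node l => by
    intro u hu
    simp only [graft, List.mem_cons, List.mem_map] at hu
    rcases hu with rfl | ⟨m, hm, rfl⟩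
    · simp [cuts, cutsList]
    · simpa [cuts] using mem_cutsList_of_mem_graftList t l m hm
theorem mem_cutsList_of_mem_graftList (t : OTree) :
    ∀ (l : List OTree), ∀ m ∈ graftList t l, (t, l) ∈ cutsList m
  | [] => by simp [graftList]
  | s :: l => by
    intro m hm
    simp only [graftList, List.mem_append, List.mem_map] at hm
    rcases hm with ⟨x, hx, rfl⟩ | ⟨k, hk, rfl⟩
    · have := mem_cuts_of_mem_graft t s x hx
      simp [cutsList, this]
    · have := mem_cutsList_of_mem_graftList t l k hk
      simp [cutsList, this]
end

mutual
theorem exists_graft_of_mem_cuts : ∀ (u : OTree), ∀ x ∈ cuts u, ∃ w ∈ graft x.1 x.2, Iso w u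
  | node l => by
    intro x hx
    simp only [cuts, List.mem_map] at hx
    obtain ⟨y, hy, rfl⟩ := hx
    rcases exists_graftList_of_mem_cutsList l y hy with h | ⟨m, hm, h⟩
    · exact ⟨_, by simp [graft], Iso.perm h⟩
    · exact ⟨node m, by simp [graft, hm], h⟩
theorem exists_graftList_of_mem_cutsList : ∀ (l : List OTree), ∀ x ∈ cutsList l,
    (x.1 :: x.2).Perm l ∨ ∃ m ∈ graftList x.1 x.2, Iso (node m) (node l)
  | [] => by simp [cutsList]
  | s :: l => by
    intro x hx
    simp only [cutsList, List.mem_cons, List.mem_append, List.mem_map] at hx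
    rcases hx with rfl | ⟨y, hy, rfl⟩ | ⟨y, hy, rfl⟩
    · exact Or.inl (List.Perm.refl _)
    · obtain ⟨w, hw, h⟩ := exists_graft_of_mem_cuts s y hy
      exact Or.inr ⟨w :: l, by simp [graftList, hw], Iso.cons l h⟩
    · rcases exists_graftList_of_mem_cutsList l y hy with h | ⟨m, hm, h⟩
      · exact Or.inl ((List.Perm.swap _ _ _).trans (h.cons s))
      · exact Or.inr ⟨s :: m, by simp [graftList, hm], Iso.tail s h⟩
end

end OTree

/-- Cutting and grafting are inverse to each other. Hence `numCuts r p u` and `numGrafts r p u`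
vanish unless `u` is an entry of `graft r p`, equivalently `(p, r)` is an entry of `cuts u`. -/
theorem RTree.mem_cuts_iff (p r u : RTree) : (p, r) ∈ u.cuts ↔ u ∈ r.graft p := by
  induction p using Quotient.inductionOn with | _ p
  induction r using Quotient.inductionOn with | _ r
  induction u using Quotient.inductionOn with | _ u
  constructor
  · intro h
    change (p.toRooted, r.toRooted) ∈
      (OTree.cuts u : Multiset (OTree × OTree)).map (Prod.map OTree.toRooted OTree.toRooted) at h
    change u.toRooted ∈ (OTree.graft p r : Multiset OTree).map OTree.toRooted
    obtain ⟨x, hx, e⟩ := Multiset.mem_map.1 h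
    obtain ⟨w, hw, hi⟩ := OTree.exists_graft_of_mem_cuts u x hx
    have h₁ : OTree.Iso x.1 p := Quotient.exact (congrArg Prod.fst e)
    have h₂ : OTree.Iso x.2 r := Quotient.exact (congrArg Prod.snd e)
    have h₃ : OTree.toRooted w ∈ (OTree.graft p r : Multiset OTree).map OTree.toRooted := by
      rw [← OTree.graft_iso h₁ h₂]
      exact Multiset.mem_map_of_mem _ hw
    rw [OTree.toRooted_eq hi] at h₃
    exact h₃
  · intro h
    change u.toRooted ∈ (OTree.graft p r : Multiset OTree).map OTree.toRooted at h
    change (p.toRooted, r.toRooted) ∈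
      (OTree.cuts u : Multiset (OTree × OTree)).map (Prod.map OTree.toRooted OTree.toRooted)
    obtain ⟨w, hw, e⟩ := Multiset.mem_map.1 h
    have h₁ : OTree.Iso w u := Quotient.exact e
    have h₂ := OTree.mem_cuts_of_mem_graft p r w hw
    have h₃ : (p.toRooted, r.toRooted) ∈
        (OTree.cuts w : Multiset (OTree × OTree)).map
          (Prod.map OTree.toRooted OTree.toRooted) :=
      Multiset.mem_map.2 ⟨_, h₂, rfl⟩
    rw [OTree.cuts_iso h₁] at h₃
    exact h₃

/-! ### The insertion-elimination Lie algebra -/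

/-- The generators `D⁺_t`, `D⁻_t` (`t` a rooted tree) and `d`. -/
inductive Generator : Type
  | plus (t : RTree)
  | minus (t : RTree)
  | grading

namespace Relator

open RTree

local notation "P" => fun t => FreeLieAlgebra.of ℂ (Generator.plus t)
local notation "M" => fun t => FreeLieAlgebra.of ℂ (Generator.minus t)
local notation "δ" => FreeLieAlgebra.of ℂ Generator.grading

/-- `[D⁺_{t₁}, D⁺_{t₂}] = ∑_{v ∈ V(t₂)} D⁺_{t₂ ∪_v t₁} - ∑_{v ∈ V(t₁)} D⁺_{t₁ ∪_v t₂}`. -/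
noncomputable def plusPlus (t₁ t₂ : RTree) : FreeLieAlgebra ℂ Generator :=
  ⁅P t₁, P t₂⁆ - (((graft t₂ t₁).map P).sum - ((graft t₁ t₂).map P).sum)

/-- `[D⁻_{t₁}, D⁻_{t₂}] = ∑_t #{e ∈ E(t) | R_e(t) = t₁, P_e(t) = t₂} D⁻_t
- ∑_t #{e ∈ E(t) | R_e(t) = t₂, P_e(t) = t₁} D⁻_t`; all trees `t` with a non-zero coefficient
occur in the finite sums. -/
noncomputable def minusMinus (t₁ t₂ : RTree) : FreeLieAlgebra ℂ Generator :=
  ⁅M t₁, M t₂⁆ - (∑ t ∈ (graft t₁ t₂).toFinset, (numCuts t₁ t₂ t : ℂ) • M t -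
    ∑ t ∈ (graft t₂ t₁).toFinset, (numCuts t₂ t₁ t : ℂ) • M t)

/-- `[D⁻_{t₁}, D⁺_{t₂}] = ∑_t #{e ∈ E(t₂) | R_e(t₂) = t, P_e(t₂) = t₁} D⁺_t
+ ∑_t #{v ∈ V(t) | t ∪_v t₂ = t₁} D⁻_t`; all trees `t` with a non-zero coefficient
occur in the finite sums. -/
noncomputable def minusPlus (t₁ t₂ : RTree) : FreeLieAlgebra ℂ Generator :=
  ⁅M t₁, P t₂⁆ - (∑ t ∈ ((cuts t₂).map Prod.snd).toFinset, (numCuts t t₁ t₂ : ℂ) • P t +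
    ∑ t ∈ ((cuts t₁).map Prod.snd).toFinset, (numGrafts t t₂ t₁ : ℂ) • M t)

/-- `[D⁻_t, D⁺_t] = d`. -/
noncomputable def minusPlusSame (t : RTree) : FreeLieAlgebra ℂ Generator :=
  ⁅M t, P t⁆ - δ

/-- `[d, D⁻_t] = -|t| D⁻_t`. -/
noncomputable def gradingMinus (t : RTree) : FreeLieAlgebra ℂ Generator :=
  ⁅δ, M t⁆ - (-(numVertices t : ℂ)) • M t

/-- `[d, D⁺_t] = |t| D⁺_t`. -/
noncomputable def gradingPlus (t : RTree) : FreeLieAlgebra ℂ Generator :=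
  ⁅δ, P t⁆ - (numVertices t : ℂ) • P t

/-- All defining relators. -/
def all : Set (FreeLieAlgebra ℂ Generator) :=
  {x | ∃ t₁ t₂, x = plusPlus t₁ t₂} ∪ {x | ∃ t₁ t₂, x = minusMinus t₁ t₂} ∪
    {x | ∃ t₁ t₂, t₁ ≠ t₂ ∧ x = minusPlus t₁ t₂} ∪ {x | ∃ t, x = minusPlusSame t} ∪
    {x | ∃ t, x = gradingMinus t} ∪ {x | ∃ t, x = gradingPlus t}

/-- The ideal of the free Lie algebra generated by the relators. -/
noncomputable def ideal : LieIdeal ℂ (FreeLieAlgebra ℂ Generator) :=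
  LieSubmodule.lieSpan ℂ (FreeLieAlgebra ℂ Generator) all

end Relator

/-- The insertion-elimination Lie algebra: the complex Lie algebra with generators `D⁺_t`, `D⁻_t`,
`d` and the relations listed above. -/
def InsElim : Type := FreeLieAlgebra ℂ Generator ⧸ Relator.ideal

namespace InsElim

noncomputable instance : LieRing InsElim :=
  inferInstanceAs (LieRing (FreeLieAlgebra ℂ Generator ⧸ Relator.ideal))

noncomputable instance : LieAlgebra ℂ InsElim :=
  inferInstanceAs (LieAlgebra ℂ (FreeLieAlgebra ℂ Generator ⧸ Relator.ideal))

/-- The class of a generator. -/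
noncomputable def gen (x : Generator) : InsElim :=
  LieSubmodule.Quotient.mk (N := Relator.ideal) (FreeLieAlgebra.of ℂ x)

/-- `D⁺_t`. -/
noncomputable def Dplus (t : RTree) : InsElim := gen (Generator.plus t)

/-- `D⁻_t`. -/
noncomputable def Dminus (t : RTree) : InsElim := gen (Generator.minus t)

/-- `d`. -/
noncomputable def d : InsElim := gen Generator.grading

/-- `𝔫₊`, the Lie subalgebra generated by the `D⁺_t`. -/
noncomputable def nPlus : LieSubalgebra ℂ InsElim :=
  LieSubalgebra.lieSpan ℂ InsElim (Set.range Dplus)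

/-- `𝔫₋`, the Lie subalgebra generated by the `D⁻_t`. -/
noncomputable def nMinus : LieSubalgebra ℂ InsElim :=
  LieSubalgebra.lieSpan ℂ InsElim (Set.range Dminus)

end InsElim

end InsertionElimination

/-!
The insertion-elimination Lie algebra is the span of its generators, and the generators act on
trees by linearly independent operators; everything else follows from these two facts.

*The action.* The operators have to satisfy the defining relations. Every tree is a forest with its
roots joined to a new root (`join`), and forests are the monomials of the polynomial algebra in the
trees. There the operators take a simple shape: `D⁺_t` is multiplication by `t` (joining `t` to the
new root) plus a derivation, `D⁻_t` is a derivation, and `d` is `1` plus a derivation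
(`insertOp_join`, `elimOp_join`, `gradOp_join`). On a single tree `s` the derivation is again the
operator itself, up to the constant `δ_{s,t}` in the case of `D⁻_t` (cutting the edge to the new
root). Operators of this shape are closed under commutators (`IsLift.mul_sub_mul`) and, by
induction on trees, determined by the multiplier and the constants (`IsLift.eq_zero`). Hence each
relation has to be compared only in these two entries (`IsLift.mul_sub_mul_eq`), where it becomes
the definition of its structure constants.

*The basis.* The relations show that the span of the generators is closed under the bracket, so
that it is everything (`InsElim.span_range_gen`). The coefficient of the one-vertex tree in the
images of the one-vertex tree and of trees with a single child of the root gives linear forms dual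
to the operators of the generators (`dualForm_genOp`). So the generators are a basis, the action is
faithful, and the triangular decomposition partitions the basis.

*Simplicity.* A non-zero ideal is stable under `ad d`, hence contains a non-zero eigenvector of it:
a multiple of `d`, or a combination of `D⁺_t`, or of `D⁻_t`, with `t` of a fixed size. The bracket
of `D⁻_s` with `D⁺_t` vanishes for distinct trees of the same size and is `d` for `s = t`, so the
ideal contains `d`, and then all generators, as these are eigenvectors of `ad d` (with non-zero
eigenvalue, except for `d` itself).
-/

namespace InsertionElimination

open MvPolynomial

/-! ### Rooted trees as root-joined forests -/

namespace OTree

theorem Iso.of_forall₂ {l l' : List OTree} (h : List.Forall₂ Iso l l') :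
    Iso (node l) (node l') := by
  induction h with
  | nil => exact Iso.refl _
  | @cons _ b l _ h _ ih => exact (Iso.cons l h).trans (Iso.tail b ih)

theorem Iso.of_map_perm {l l' : List OTree} (h : (l.map toRooted).Perm (l'.map toRooted)) :
    Iso (node l) (node l') := by
  have h' : List.Forall₂ (fun x y => x = toRooted y) (l'.map toRooted) l' := by
    rw [List.forall₂_map_left_iff]
    exact List.forall₂_same.2 fun _ _ => rfl
  obtain ⟨m, hm, hp⟩ := List.perm_comp_forall₂ h h'
  rw [List.forall₂_map_left_iff] at hm
  exact (Iso.of_forall₂ (hm.imp fun _ _ e => Quotient.exact e)).trans (Iso.perm hp)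

theorem size_lt_of_mem {l : List OTree} {s : OTree} (h : s ∈ l) : s.size < (node l).size := by
  suffices s.size ≤ sizeList l by rw [size]; omega
  induction l with
  | nil => simp at h
  | cons a l ih =>
    rw [sizeList]
    rcases List.mem_cons.1 h with rfl | h
    · omega
    · have := ih h
      omega

end OTree

namespace RTree

/-- An ordered tree that represents the given rooted tree. -/
noncomputable def ordered (t : RTree) : OTree := Quotient.out t

theorem toRooted_ordered (t : RTree) : t.ordered.toRooted = t := Quotient.out_eq t

theorem map_toRooted_ordered (l : List RTree) : (l.map ordered).map OTree.toRooted = l := by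
  simp [Function.comp_def, toRooted_ordered]

/-- The rooted tree whose root has the given multiset of children. -/
noncomputable def joinRoots (m : Multiset RTree) : RTree :=
  (OTree.node (m.toList.map ordered)).toRooted

theorem joinRoots_map_toRooted (l : List OTree) :
    joinRoots (l.map OTree.toRooted : List RTree) = (OTree.node l).toRooted := by
  refine OTree.toRooted_eq (OTree.Iso.of_map_perm ?_)
  rw [map_toRooted_ordered]
  exact Multiset.coe_eq_coe.1 (Multiset.coe_toList _)

end RTree

/-- The complex vector space with basis the rooted trees. -/
abbrev TreeSpace : Type := RTree →₀ ℂ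

/-- The polynomial algebra in the rooted trees; its monomials are the forests. -/
abbrev ForestAlgebra : Type := MvPolynomial RTree ℂ

/-- A tree as a forest with one component. -/
noncomputable def toForest : TreeSpace →ₗ[ℂ] ForestAlgebra := Finsupp.linearCombination ℂ X

@[simp] theorem toForest_single (s : RTree) : toForest (Finsupp.single s 1) = X s := by
  simp [toForest]

/-- Joining the roots of the components of a forest to a new root. -/
noncomputable def join : ForestAlgebra →ₗ[ℂ] TreeSpace :=
  (basisMonomials RTree ℂ).constr ℂ
    fun m => Finsupp.single (RTree.joinRoots (Finsupp.toMultiset m)) 1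

/-- The forest with the given list of components. -/
noncomputable def forest (l : List OTree) : ForestAlgebra :=
  (l.map fun s => X s.toRooted).prod

@[simp] theorem forest_nil : forest [] = 1 := rfl

@[simp] theorem forest_cons (s : OTree) (l : List OTree) :
    forest (s :: l) = X s.toRooted * forest l := by
  simp [forest]

theorem forest_eq_monomial (l : List OTree) :
    forest l = monomial (Multiset.toFinsupp (l.map OTree.toRooted : List RTree)) 1 := by
  induction l with
  | nil => simp
  | cons s l ih =>
    rw [forest_cons, ih, X, monomial_mul, List.map_cons, ← Multiset.cons_coe,
      ← Multiset.singleton_add, map_add, Multiset.toFinsupp_singleton, one_mul]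

theorem join_forest (l : List OTree) :
    join (forest l) = Finsupp.single (OTree.node l).toRooted 1 := by
  have h := (basisMonomials RTree ℂ).constr_basis ℂ
    (fun m => Finsupp.single (RTree.joinRoots (Finsupp.toMultiset m)) (1 : ℂ))
    (Multiset.toFinsupp (l.map OTree.toRooted : List RTree))
  rw [coe_basisMonomials, Multiset.toFinsupp_toMultiset, RTree.joinRoots_map_toRooted] at h
  rw [forest_eq_monomial]
  exact h

theorem forest_induction {p : ForestAlgebra → Prop} (hl : ∀ l, p (forest l))
    (hadd : ∀ f g, p f → p g → p (f + g)) (hsmul : ∀ (c : ℂ) f, p f → p (c • f))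
    (f : ForestAlgebra) : p f := by
  induction f using MvPolynomial.induction_on' with
  | add f g hf hg => exact hadd f g hf hg
  | monomial m c =>
    have e : forest ((Finsupp.toMultiset m).toList.map RTree.ordered) = monomial m 1 := by
      rw [forest_eq_monomial, RTree.map_toRooted_ordered, Multiset.coe_toList,
        Finsupp.toMultiset_toFinsupp]
    have h := hsmul c _ (hl ((Finsupp.toMultiset m).toList.map RTree.ordered))
    rwa [e, smul_monomial, smul_eq_mul, mul_one] at h

/-! ### Insertion, elimination and grading operators -/

/-- The insertion operator `s ↦ ∑_v s ∪_v t`. -/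
noncomputable def insertOp (t : RTree) : Module.End ℂ TreeSpace :=
  Finsupp.linearCombination ℂ
    fun s => ((s.graft t).map fun u => Finsupp.single u (1 : ℂ)).sum

/-- The elimination operator `s ↦ ∑_{P_e(s) = t} R_e(s)`. -/
noncomputable def elimOp (t : RTree) : Module.End ℂ TreeSpace :=
  Finsupp.linearCombination ℂ
    fun s => ((s.cuts.filter fun e => e.1 = t).map fun e => Finsupp.single e.2 (1 : ℂ)).sum

/-- The grading operator `s ↦ |s| s`. -/
noncomputable def gradOp : Module.End ℂ TreeSpace :=
  Finsupp.linearCombination ℂ fun s => Finsupp.single s (s.numVertices : ℂ)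

theorem insertOp_single (t s : RTree) : insertOp t (Finsupp.single s 1) =
    ((s.graft t).map fun u => Finsupp.single u (1 : ℂ)).sum := by
  simp [insertOp]

theorem elimOp_single (t s : RTree) : elimOp t (Finsupp.single s 1) =
    ((s.cuts.filter fun e => e.1 = t).map fun e => Finsupp.single e.2 (1 : ℂ)).sum := by
  simp [elimOp]

theorem gradOp_single (s : RTree) :
    gradOp (Finsupp.single s 1) = Finsupp.single s (s.numVertices : ℂ) := by
  simp [gradOp]

theorem sum_single_apply (m : Multiset RTree) (u : RTree) :
    (m.map fun s => Finsupp.single s (1 : ℂ)).sum u = m.count u := by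
  induction m using Multiset.induction_on with
  | empty => simp
  | cons a m ih =>
    rw [Multiset.map_cons, Multiset.sum_cons, Finsupp.add_apply, ih, Multiset.count_cons,
      Finsupp.single_apply]
    simp only [eq_comm (a := a)]
    split_ifs <;> simp [add_comm]

theorem insertOp_single_apply (t s u : RTree) :
    insertOp t (Finsupp.single s 1) u = s.numGrafts t u := by
  rw [insertOp_single, sum_single_apply, RTree.numGrafts]

theorem elimOp_single_apply (t s u : RTree) :
    elimOp t (Finsupp.single s 1) u = RTree.numCuts u t s := by
  rw [elimOp_single, RTree.numCuts]
  generalize s.cuts = m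
  induction m using Multiset.induction_on with
  | empty => simp
  | cons a m ih =>
    obtain ⟨p, r⟩ := a
    by_cases h : p = t
    · subst h
      by_cases h' : r = u
      · subst h'
        simp [ih, add_comm]
      · simp [ih, Ne.symm h']
    · simp [ih, h, Ne.symm h]

/-! ### Lifting operators to forests -/

/-- The part of insertion that joins the new tree to a vertex of a forest. -/
noncomputable def insertDer (t : RTree) : Derivation ℂ ForestAlgebra ForestAlgebra :=
  mkDerivation ℂ fun s => toForest (insertOp t (Finsupp.single s 1))

/-- Removal of a branch `t` from a forest. A component equal to `t` may be removed altogether: in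
the joined tree it is cut off by the edge to the new root. -/
noncomputable def elimDer (t : RTree) : Derivation ℂ ForestAlgebra ForestAlgebra :=
  mkDerivation ℂ fun s => C (Finsupp.single s 1 t) + toForest (elimOp t (Finsupp.single s 1))

/-- The number of vertices of a forest. -/
noncomputable def gradDer : Derivation ℂ ForestAlgebra ForestAlgebra :=
  mkDerivation ℂ fun s => toForest (gradOp (Finsupp.single s 1))

theorem insertDer_X (t s : RTree) :
    insertDer t (X s) = toForest (insertOp t (Finsupp.single s 1)) :=
  mkDerivation_X _ _ _

theorem elimDer_X (t s : RTree) : elimDer t (X s) =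
    C (Finsupp.single s 1 t) + toForest (elimOp t (Finsupp.single s 1)) :=
  mkDerivation_X _ _ _

theorem gradDer_X (s : RTree) : gradDer (X s) = toForest (gradOp (Finsupp.single s 1)) :=
  mkDerivation_X _ _ _

theorem insertOp_toRooted (t s : OTree) : insertOp t.toRooted (Finsupp.single s.toRooted 1) =
    ((OTree.graft t s).map fun u => Finsupp.single u.toRooted (1 : ℂ)).sum := by
  rw [insertOp_single]
  change (Multiset.map _ (Multiset.map OTree.toRooted (OTree.graft t s : Multiset OTree))).sum = _
  rw [Multiset.map_coe, Multiset.map_coe, Multiset.sum_coe, List.map_map]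
  rfl

theorem elimOp_toRooted (t : RTree) (s : OTree) : elimOp t (Finsupp.single s.toRooted 1) =
    ((OTree.cuts s).map fun x =>
      if x.1.toRooted = t then Finsupp.single x.2.toRooted (1 : ℂ) else 0).sum := by
  rw [elimOp_single]
  change (Multiset.map _ (Multiset.filter _ (Multiset.map (Prod.map OTree.toRooted OTree.toRooted)
    (OTree.cuts s : Multiset (OTree × OTree))))).sum = _
  generalize OTree.cuts s = c
  induction c with
  | nil => simp
  | cons x c ih =>
    rw [← Multiset.cons_coe, Multiset.map_cons]
    by_cases h : x.1.toRooted = t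
    · simp [h, ← ih]
    · simp [h, ← ih]

theorem insertDer_forest (t : OTree) (l : List OTree) :
    insertDer t.toRooted (forest l) = ((OTree.graftList t l).map forest).sum := by
  induction l with
  | nil => simp [OTree.graftList]
  | cons s l ih =>
    rw [forest_cons, Derivation.leibniz, ih, insertDer_X, insertOp_toRooted, map_list_sum,
      OTree.graftList]
    simp [Function.comp_def, List.sum_map_mul_left, List.sum_map_mul_right, mul_comm, add_comm]

theorem elimDer_forest (t : RTree) (l : List OTree) : elimDer t (forest l) =
    ((OTree.cutsList l).map fun x => if x.1.toRooted = t then forest x.2 else 0).sum := by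
  induction l with
  | nil => simp [OTree.cutsList]
  | cons s l ih =>
    have e₁ : ((OTree.cuts s).map fun x =>
        if x.1.toRooted = t then forest (x.2 :: l) else 0).sum =
        forest l * toForest (elimOp t (Finsupp.single s.toRooted 1)) := by
      rw [elimOp_toRooted, map_list_sum, List.map_map, ← List.sum_map_mul_left]
      congr 2
      funext x
      by_cases h : x.1.toRooted = t <;> simp [h, mul_comm]
    have e₂ : ((OTree.cutsList l).map fun x =>
        if x.1.toRooted = t then forest (s :: x.2) else 0).sum =
        X s.toRooted * elimDer t (forest l) := by
      rw [ih, ← List.sum_map_mul_left]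
      congr 2
      funext x
      by_cases h : x.1.toRooted = t <;> simp [h]
    rw [forest_cons, Derivation.leibniz, elimDer_X, OTree.cutsList, List.map_cons, List.map_append,
      List.map_map, List.map_map, List.sum_cons, List.sum_append, Function.comp_def,
      Function.comp_def, e₁, e₂, Finsupp.single_apply]
    by_cases h : s.toRooted = t <;> simp [h] <;> ring

theorem gradDer_forest (l : List OTree) :
    gradDer (forest l) = (OTree.sizeList l : ℂ) • forest l := by
  induction l with
  | nil => simp [OTree.sizeList]
  | cons s l ih =>
    have e : toForest (gradOp (Finsupp.single s.toRooted 1)) =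
        (OTree.size s : ℂ) • X s.toRooted := by
      rw [gradOp_single, toForest, Finsupp.linearCombination_single]
      rfl
    rw [forest_cons, Derivation.leibniz, ih, gradDer_X, e, OTree.sizeList]
    simp only [smul_eq_mul, MvPolynomial.smul_eq_C_mul, Nat.cast_add, C_add]
    ring

theorem insertOp_join (t : RTree) (f : ForestAlgebra) :
    insertOp t (join f) = join (X t * f + insertDer t f) := by
  induction f using forest_induction with
  | hadd f g hf hg => simp only [map_add, hf, hg, mul_add]; abel
  | hsmul c f hf =>
    rw [map_smul, map_smul, hf, mul_smul_comm, Derivation.map_smul, ← smul_add, map_smul]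
  | hl l =>
    obtain ⟨t, rfl⟩ : ∃ t' : OTree, t'.toRooted = t := ⟨t.ordered, t.toRooted_ordered⟩
    rw [← forest_cons, map_add, join_forest, join_forest, insertOp_toRooted, insertDer_forest,
      OTree.graft, map_list_sum]
    simp [Function.comp_def, join_forest]

theorem elimOp_join (t : RTree) (f : ForestAlgebra) :
    elimOp t (join f) = join (elimDer t f) := by
  induction f using forest_induction with
  | hadd f g hf hg => simp only [map_add, hf, hg]
  | hsmul c f hf => rw [map_smul, map_smul, hf, Derivation.map_smul, map_smul]
  | hl l =>
    rw [join_forest, elimOp_toRooted, elimDer_forest, OTree.cuts, map_list_sum, List.map_map,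
      List.map_map]
    congr 2
    funext x
    by_cases h : x.1.toRooted = t <;> simp [h, join_forest]

theorem gradOp_join (f : ForestAlgebra) : gradOp (join f) = join (f + gradDer f) := by
  induction f using forest_induction with
  | hadd f g hf hg => simp only [map_add, hf, hg]; abel
  | hsmul c f hf => rw [map_smul, map_smul, hf, Derivation.map_smul, ← smul_add, map_smul]
  | hl l =>
    rw [map_add, gradDer_forest, map_smul, join_forest, gradOp_single]
    change Finsupp.single _ ((OTree.size (OTree.node l) : ℕ) : ℂ) = _
    rw [OTree.size, Finsupp.smul_single, ← Finsupp.single_add]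
    simp

/-! ### Commutators of operators that lift to forests -/

/-- Through the joining of roots, the operator `A` on trees is the operator `f ↦ q * f + D f` on
forests, and `D` sends a tree `s`, as a forest, to the constant `k s` plus the forest of `A s`.
For an insertion operator `q` is the tree joined to the new root, and for an elimination operator
`k s` accounts for the removal of the whole component `s` by cutting its edge to the new root. -/
structure IsLift (A : Module.End ℂ TreeSpace) (q : ForestAlgebra)
    (D : Derivation ℂ ForestAlgebra ForestAlgebra) (k : TreeSpace →ₗ[ℂ] ℂ) : Prop where
  apply_join : ∀ f, A (join f) = join (q * f + D f)
  apply_X : ∀ s, D (X s) = C (k (Finsupp.single s 1)) + toForest (A (Finsupp.single s 1))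

namespace IsLift

variable {A A' A'' : Module.End ℂ TreeSpace} {q q' q'' : ForestAlgebra}
  {D D' D'' : Derivation ℂ ForestAlgebra ForestAlgebra} {k k' k'' : TreeSpace →ₗ[ℂ] ℂ}

theorem zero : IsLift 0 0 0 0 := ⟨by simp, by simp⟩

theorem add (h : IsLift A q D k) (h' : IsLift A' q' D' k') :
    IsLift (A + A') (q + q') (D + D') (k + k') := by
  refine ⟨fun f => ?_, fun s => ?_⟩
  · simp only [LinearMap.add_apply, Derivation.add_apply, h.apply_join, h'.apply_join, add_mul,
      map_add]
    abel
  · simp only [LinearMap.add_apply, Derivation.add_apply, h.apply_X, h'.apply_X, map_add]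
    abel

theorem smul (c : ℂ) (h : IsLift A q D k) : IsLift (c • A) (c • q) (c • D) (c • k) := by
  refine ⟨fun f => ?_, fun s => ?_⟩
  · simp only [LinearMap.smul_apply, Derivation.smul_apply, h.apply_join, smul_mul_assoc,
      map_add, map_smul, smul_add]
  · simp only [LinearMap.smul_apply, Derivation.smul_apply, h.apply_X, smul_add, map_smul,
      smul_eq_mul, C_mul, MvPolynomial.smul_eq_C_mul]

theorem sub (h : IsLift A q D k) (h' : IsLift A' q' D' k') :
    IsLift (A - A') (q - q') (D - D') (k - k') := by
  have h₀ := h.add (h'.smul (-1))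
  rwa [neg_one_smul, neg_one_smul ℂ A', neg_one_smul ℂ D', neg_one_smul, ← sub_eq_add_neg,
    ← sub_eq_add_neg, ← sub_eq_add_neg, ← sub_eq_add_neg] at h₀

theorem sum {ι : Type*} (m : Finset ι) {A : ι → Module.End ℂ TreeSpace} {q : ι → ForestAlgebra}
    {D : ι → Derivation ℂ ForestAlgebra ForestAlgebra} {k : ι → TreeSpace →ₗ[ℂ] ℂ}
    (h : ∀ i, IsLift (A i) (q i) (D i) (k i)) :
    IsLift (∑ i ∈ m, A i) (∑ i ∈ m, q i) (∑ i ∈ m, D i) (∑ i ∈ m, k i) := by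
  classical
  induction m using Finset.induction_on with
  | empty => exact zero
  | insert i m hi ih =>
    simp only [Finset.sum_insert hi]
    exact (h i).add ih

/-- By induction on trees, an operator is determined by the parts `q` and `k` of a lift. -/
theorem eq_zero (h : IsLift A 0 D 0) : A = 0 := by
  have key : ∀ (n : ℕ) (s : OTree), s.size = n → A (Finsupp.single s.toRooted 1) = 0 := by
    intro n
    induction n using Nat.strong_induction_on with
    | _ n ih =>
      rintro ⟨l⟩ rfl
      have hD : ∀ m : List OTree, (∀ s ∈ m, s ∈ l) → D (forest m) = 0 := by
        intro m hm
        induction m with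
        | nil => simp
        | cons s m ihm =>
          rw [forest_cons, Derivation.leibniz, ihm fun u hu => hm u (List.mem_cons_of_mem _ hu),
            h.apply_X, ih _ (OTree.size_lt_of_mem (hm s List.mem_cons_self)) s rfl]
          simp
      rw [← join_forest, h.apply_join, hD l fun _ hs => hs, zero_mul, add_zero, map_zero]
  refine Finsupp.lhom_ext' fun s => LinearMap.ext_ring ?_
  induction s using Quotient.inductionOn with | _ s
  exact key _ s rfl

theorem apply_toForest (h : IsLift A q D k) (v : TreeSpace) :
    D (toForest v) = C (k v) + toForest (A v) := by
  induction v using Finsupp.induction_linear with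
  | zero => simp
  | add v w hv hw => simp only [map_add, hv, hw]; abel
  | single s c =>
    rw [← mul_one c, ← smul_eq_mul, ← Finsupp.smul_single, map_smul, Derivation.map_smul,
      toForest_single, h.apply_X]
    simp only [map_smul, smul_add, smul_eq_mul, C_mul, MvPolynomial.smul_eq_C_mul]

/-- Lifts are closed under commutators. -/
theorem mul_sub_mul (h : IsLift A q D k) (h' : IsLift A' q' D' k') :
    IsLift (A * A' - A' * A) (D q' - D' q) ⁅D, D'⁆ (k ∘ₗ A' - k' ∘ₗ A) := by
  refine ⟨fun f => ?_, fun s => ?_⟩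
  · rw [LinearMap.sub_apply, Module.End.mul_apply,
      Module.End.mul_apply, h.apply_join, h'.apply_join, h.apply_join, h'.apply_join, ← map_sub]
    congr 1
    simp only [Derivation.commutator_apply, map_add, Derivation.leibniz, smul_eq_mul]
    ring
  · have hC : ∀ c : ℂ, D (C c) = 0 := fun c => D.map_algebraMap c
    have hC' : ∀ c : ℂ, D' (C c) = 0 := fun c => D'.map_algebraMap c
    simp only [LinearMap.sub_apply, Module.End.mul_apply,
      Derivation.commutator_apply, LinearMap.comp_apply, map_sub, h.apply_X, h'.apply_X, map_add,
      h.apply_toForest, h'.apply_toForest, hC, hC']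
    abel

/-- A formula for the commutator of two operators follows from the corresponding formulas for the
parts `q` and `k` of their lifts. -/
theorem mul_sub_mul_eq (h : IsLift A q D k) (h' : IsLift A' q' D' k') (h'' : IsLift A'' q'' D'' k'')
    (hq : D q' - D' q = q'')
    (hk : ∀ s, k (A' (Finsupp.single s 1)) - k' (A (Finsupp.single s 1)) =
      k'' (Finsupp.single s 1)) : (A * A' - A' * A) = A'' := by
  have hk' : k ∘ₗ A' - k' ∘ₗ A = k'' := Finsupp.lhom_ext' fun s => LinearMap.ext_ring (hk s)
  have h₀ := (h.mul_sub_mul h').sub h''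
  rw [hq, hk', sub_self, sub_self] at h₀
  exact sub_eq_zero.1 h₀.eq_zero

end IsLift

theorem isLift_insertOp (t : RTree) : IsLift (insertOp t) (X t) (insertDer t) 0 :=
  ⟨insertOp_join t, fun s => by simp [insertDer_X]⟩

theorem isLift_elimOp (t : RTree) : IsLift (elimOp t) 0 (elimDer t) (Finsupp.lapply t) :=
  ⟨fun f => by simp [elimOp_join], fun s => by simp [elimDer_X]⟩

theorem isLift_gradOp : IsLift gradOp 1 gradDer 0 :=
  ⟨fun f => by simp [gradOp_join], fun s => by simp [gradDer_X]⟩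

theorem isLift_sum_insertOp (m : Multiset RTree) :
    IsLift (m.map insertOp).sum (m.map X).sum (m.map insertDer).sum 0 := by
  induction m using Multiset.induction_on with
  | empty => exact IsLift.zero
  | cons t m ih =>
    simpa only [Multiset.map_cons, Multiset.sum_cons, add_zero] using (isLift_insertOp t).add ih

/-! ### Numbers of vertices -/

namespace RTree

theorem numVertices_pos (t : RTree) : 0 < t.numVertices := by
  induction t using Quotient.inductionOn with | _ t
  obtain ⟨l⟩ := t
  change 0 < OTree.size (OTree.node l)
  rw [OTree.size]
  omega

end RTree

namespace OTree

mutual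
theorem size_of_mem_graft (t : OTree) :
    ∀ (s : OTree), ∀ u ∈ graft t s, size u = size s + size t
  | node l => by
    intro u hu
    simp only [graft, List.mem_cons, List.mem_map] at hu
    rcases hu with rfl | ⟨m, hm, rfl⟩
    · simp only [size, sizeList]; omega
    · have := size_of_mem_graftList t l m hm
      simp only [size]; omega
theorem size_of_mem_graftList (t : OTree) :
    ∀ (l : List OTree), ∀ m ∈ graftList t l, sizeList m = sizeList l + size t
  | [] => by simp [graftList]
  | s :: l => by
    intro m hm
    simp only [graftList, List.mem_append, List.mem_map] at hm
    rcases hm with ⟨x, hx, rfl⟩ | ⟨k, hk, rfl⟩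
    · have := size_of_mem_graft t s x hx
      simp only [sizeList]; omega
    · have := size_of_mem_graftList t l k hk
      simp only [sizeList]; omega
end

end OTree

namespace RTree

theorem numVertices_of_mem_graft {s t u : RTree} (h : u ∈ s.graft t) :
    u.numVertices = s.numVertices + t.numVertices := by
  induction s using Quotient.inductionOn with | _ s
  induction t using Quotient.inductionOn with | _ t
  change u ∈ (OTree.graft t s : Multiset OTree).map OTree.toRooted at h
  obtain ⟨w, hw, rfl⟩ := Multiset.mem_map.1 h
  exact OTree.size_of_mem_graft t s w hw

theorem numGrafts_eq_zero {r p u : RTree}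
    (h : u.numVertices ≠ r.numVertices + p.numVertices) : r.numGrafts p u = 0 :=
  Multiset.count_eq_zero.2 fun hu => h (numVertices_of_mem_graft hu)

theorem numCuts_eq_zero {r p u : RTree}
    (h : u.numVertices ≠ r.numVertices + p.numVertices) : numCuts r p u = 0 :=
  Multiset.count_eq_zero.2 fun hu => h (numVertices_of_mem_graft ((mem_cuts_iff p r u).1 hu))

end RTree

/-! ### The defining relations hold for the operators -/

theorem elimOp_single_eq_sum (t s : RTree) : elimOp t (Finsupp.single s 1) =
    ∑ u ∈ (s.cuts.map Prod.snd).toFinset, (RTree.numCuts u t s : ℂ) • Finsupp.single u 1 := by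
  ext u
  rw [elimOp_single_apply, Finsupp.finsetSum_apply]
  simp only [Finsupp.smul_apply, Finsupp.single_apply, smul_eq_mul, mul_ite, mul_one, mul_zero,
    Finset.sum_ite_eq']
  split_ifs with h
  · rfl
  · rw [RTree.numCuts, Multiset.count_eq_zero.2, Nat.cast_zero]
    exact fun hu => h (Multiset.mem_toFinset.2 (Multiset.mem_map_of_mem Prod.snd hu))

theorem elimOp_self (t : RTree) : elimOp t (Finsupp.single t 1) = 0 := by
  ext u
  rw [elimOp_single_apply, RTree.numCuts_eq_zero, Nat.cast_zero, Finsupp.zero_apply]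
  have := u.numVertices_pos
  omega

/-- The operators by which the generators act. -/
noncomputable def genOp : Generator → Module.End ℂ TreeSpace
  | Generator.plus t => insertOp t
  | Generator.minus t => elimOp t
  | Generator.grading => gradOp

attribute [local instance] LieRing.ofAssociativeRing

/-- The action of the free Lie algebra on trees. -/
noncomputable def freeRep : FreeLieAlgebra ℂ Generator →ₗ⁅ℂ⁆ Module.End ℂ TreeSpace :=
  FreeLieAlgebra.lift ℂ genOp

@[simp] theorem freeRep_plus (t : RTree) :
    freeRep (FreeLieAlgebra.of ℂ (Generator.plus t)) = insertOp t :=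
  FreeLieAlgebra.lift_of_apply _ _

@[simp] theorem freeRep_minus (t : RTree) :
    freeRep (FreeLieAlgebra.of ℂ (Generator.minus t)) = elimOp t :=
  FreeLieAlgebra.lift_of_apply _ _

@[simp] theorem freeRep_grading :
    freeRep (FreeLieAlgebra.of ℂ Generator.grading) = gradOp :=
  FreeLieAlgebra.lift_of_apply _ _

theorem freeRep_lie (x y : FreeLieAlgebra ℂ Generator) :
    freeRep ⁅x, y⁆ = freeRep x * freeRep y - freeRep y * freeRep x :=
  LieHom.map_lie _ _ _

theorem map_multiset_sum_map {ι A B : Type*} [AddCommMonoid A] [AddCommMonoid B] (φ : A →+ B)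
    (m : Multiset ι) (f : ι → A) : φ (m.map f).sum = (m.map fun i => φ (f i)).sum := by
  rw [map_multiset_sum, Multiset.map_map]
  rfl

theorem toForest_insertOp (t s : RTree) :
    toForest (insertOp t (Finsupp.single s 1)) = ((s.graft t).map X).sum := by
  rw [insertOp_single]
  exact (map_multiset_sum_map toForest.toAddMonoidHom _ _).trans (by simp)

theorem toForest_elimOp (t s : RTree) : toForest (elimOp t (Finsupp.single s 1)) =
    ∑ u ∈ (s.cuts.map Prod.snd).toFinset, (RTree.numCuts u t s : ℂ) • X u := by
  simp only [elimOp_single_eq_sum, map_sum, map_smul, toForest_single]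

theorem commutator_insertOp_insertOp (t₁ t₂ : RTree) :
    insertOp t₁ * insertOp t₂ - insertOp t₂ * insertOp t₁ =
    ((t₂.graft t₁).map insertOp).sum - ((t₁.graft t₂).map insertOp).sum := by
  refine (isLift_insertOp t₁).mul_sub_mul_eq (isLift_insertOp t₂)
    ((isLift_sum_insertOp _).sub (isLift_sum_insertOp _)) ?_ fun s => ?_
  · simp only [insertDer_X, toForest_insertOp]
  · simp

theorem sum_numCuts_mul_single (r p s : RTree) :
    ∑ t ∈ (r.graft p).toFinset, (RTree.numCuts r p t : ℂ) * Finsupp.single s (1 : ℂ) t =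
      RTree.numCuts r p s := by
  simp only [Finsupp.single_apply, mul_ite, mul_one, mul_zero, Finset.sum_ite_eq]
  split_ifs with h
  · rfl
  · rw [RTree.numCuts, Multiset.count_eq_zero.2, Nat.cast_zero]
    exact fun hu => h (Multiset.mem_toFinset.2 ((RTree.mem_cuts_iff p r s).1 hu))

theorem sum_numGrafts_mul_single (p u s : RTree) :
    ∑ t ∈ (u.cuts.map Prod.snd).toFinset,
      (t.numGrafts p u : ℂ) * Finsupp.single s (1 : ℂ) t = s.numGrafts p u := by
  simp only [Finsupp.single_apply, mul_ite, mul_one, mul_zero, Finset.sum_ite_eq]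
  split_ifs with h
  · rfl
  · rw [RTree.numGrafts, Multiset.count_eq_zero.2, Nat.cast_zero]
    exact fun hu => h (Multiset.mem_toFinset.2
      (Multiset.mem_map.2 ⟨_, (RTree.mem_cuts_iff p s u).2 hu, rfl⟩))

theorem commutator_elimOp_elimOp (t₁ t₂ : RTree) :
    elimOp t₁ * elimOp t₂ - elimOp t₂ * elimOp t₁ =
    ∑ t ∈ (t₁.graft t₂).toFinset, (RTree.numCuts t₁ t₂ t : ℂ) • elimOp t -
      ∑ t ∈ (t₂.graft t₁).toFinset, (RTree.numCuts t₂ t₁ t : ℂ) • elimOp t := by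
  refine (isLift_elimOp t₁).mul_sub_mul_eq (isLift_elimOp t₂)
    ((IsLift.sum _ fun t => (isLift_elimOp t).smul _).sub
      (IsLift.sum _ fun t => (isLift_elimOp t).smul _)) ?_ fun s => ?_
  · simp
  · simp only [LinearMap.sub_apply, LinearMap.sum_apply, LinearMap.smul_apply,
      Finsupp.lapply_apply, elimOp_single_apply, smul_eq_mul, sum_numCuts_mul_single]

theorem commutator_elimOp_insertOp {t₁ t₂ : RTree} (hne : t₁ ≠ t₂) :
    elimOp t₁ * insertOp t₂ - insertOp t₂ * elimOp t₁ =
    ∑ t ∈ (t₂.cuts.map Prod.snd).toFinset, (RTree.numCuts t t₁ t₂ : ℂ) • insertOp t +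
      ∑ t ∈ (t₁.cuts.map Prod.snd).toFinset, (t.numGrafts t₂ t₁ : ℂ) • elimOp t := by
  refine (isLift_elimOp t₁).mul_sub_mul_eq (isLift_insertOp t₂)
    ((IsLift.sum _ fun t => (isLift_insertOp t).smul _).add
      (IsLift.sum _ fun t => (isLift_elimOp t).smul _)) ?_ fun s => ?_
  · rw [elimDer_X, toForest_elimOp, Finsupp.single_eq_of_ne hne]
    simp
  · simp only [LinearMap.add_apply, LinearMap.sum_apply, LinearMap.smul_apply,
      Finsupp.lapply_apply, insertOp_single_apply, smul_eq_mul, sum_numGrafts_mul_single,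
      LinearMap.zero_apply, mul_zero, Finset.sum_const_zero, zero_add, sub_zero]

theorem commutator_elimOp_insertOp_self (t : RTree) :
    elimOp t * insertOp t - insertOp t * elimOp t = gradOp := by
  refine (isLift_elimOp t).mul_sub_mul_eq (isLift_insertOp t) isLift_gradOp ?_ fun s => ?_
  · rw [elimDer_X, elimOp_self, Finsupp.single_eq_same]
    simp
  · simp only [Finsupp.lapply_apply, insertOp_single_apply, LinearMap.zero_apply, sub_zero]
    rw [RTree.numGrafts_eq_zero, Nat.cast_zero]
    have := s.numVertices_pos
    omega

theorem commutator_gradOp_elimOp (t : RTree) :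
    gradOp * elimOp t - elimOp t * gradOp = (-(t.numVertices : ℂ)) • elimOp t := by
  refine isLift_gradOp.mul_sub_mul_eq (isLift_elimOp t) ((isLift_elimOp t).smul _) ?_ fun s => ?_
  · simp
  · simp only [gradOp_single, LinearMap.zero_apply, LinearMap.smul_apply, Finsupp.lapply_apply]
    by_cases h : s = t <;> simp [h]

theorem commutator_gradOp_insertOp (t : RTree) :
    gradOp * insertOp t - insertOp t * gradOp = (t.numVertices : ℂ) • insertOp t := by
  refine isLift_gradOp.mul_sub_mul_eq (isLift_insertOp t) ((isLift_insertOp t).smul _) ?_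
    fun s => ?_
  · rw [gradDer_X, gradOp_single, toForest, Finsupp.linearCombination_single]
    simp
  · simp

theorem relator_ideal_le_ker : Relator.ideal ≤ freeRep.ker := by
  refine LieSubmodule.lieSpan_le.2 ?_
  rintro x (((((⟨t₁, t₂, rfl⟩ | ⟨t₁, t₂, rfl⟩) | ⟨t₁, t₂, h, rfl⟩) | ⟨t, rfl⟩) | ⟨t, rfl⟩) |
    ⟨t, rfl⟩) <;> refine LieHom.mem_ker.2 ?_
  · have hs : ∀ m : Multiset RTree,
        freeRep (m.map fun t => FreeLieAlgebra.of ℂ (Generator.plus t)).sum =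
          (m.map insertOp).sum := fun m =>
      (map_multiset_sum_map freeRep.toLinearMap.toAddMonoidHom _ _).trans
        (congrArg _ (Multiset.map_congr rfl fun t _ => freeRep_plus t))
    rw [Relator.plusPlus, map_sub, map_sub, freeRep_lie, hs, hs, freeRep_plus,
      freeRep_plus, commutator_insertOp_insertOp, sub_self]
  · simp only [Relator.minusMinus, map_sub, freeRep_lie, map_sum, map_smul,
      freeRep_minus, commutator_elimOp_elimOp, sub_self]
  · simp only [Relator.minusPlus, map_sub, map_add, freeRep_lie, map_sum,
      map_smul, freeRep_minus, freeRep_plus, commutator_elimOp_insertOp h, sub_self]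
  · rw [Relator.minusPlusSame, map_sub, freeRep_lie, freeRep_minus, freeRep_plus,
      freeRep_grading, commutator_elimOp_insertOp_self, sub_self]
  · rw [Relator.gradingMinus, map_sub, freeRep_lie, map_smul, freeRep_minus,
      freeRep_grading, commutator_gradOp_elimOp, sub_self]
  · rw [Relator.gradingPlus, map_sub, freeRep_lie, map_smul, freeRep_plus,
      freeRep_grading, commutator_gradOp_insertOp, sub_self]

/-! ### Linear independence of the operators -/

/-- The tree with one vertex. -/
def oneVertex : RTree := (OTree.node []).toRooted

theorem join_one : join 1 = Finsupp.single oneVertex 1 := join_forest []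

theorem numVertices_oneVertex : oneVertex.numVertices = 1 := rfl

/-- The tree whose root has the single child `t`. -/
def extendRoot (t : RTree) : RTree := OTree.consR [] t

theorem join_X (t : RTree) : join (X t) = Finsupp.single (extendRoot t) 1 := by
  induction t using Quotient.inductionOn with | _ t
  have h := join_forest [t]
  rw [forest_cons, forest_nil, mul_one] at h
  exact h

theorem numVertices_extendRoot (t : RTree) :
    (extendRoot t).numVertices = 1 + t.numVertices := by
  induction t using Quotient.inductionOn with | _ t
  rfl

theorem extendRoot_ne_oneVertex (t : RTree) : extendRoot t ≠ oneVertex := by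
  intro h
  have h₁ := numVertices_extendRoot t
  rw [h, numVertices_oneVertex] at h₁
  have := t.numVertices_pos
  omega

theorem join_toForest_oneVertex (v : TreeSpace) : join (toForest v) oneVertex = 0 := by
  induction v using Finsupp.induction_linear with
  | zero => simp
  | add v w hv hw => simp [hv, hw]
  | single s c =>
    rw [← mul_one c, ← smul_eq_mul, ← Finsupp.smul_single, map_smul, map_smul, toForest_single,
      join_X, Finsupp.smul_apply, Finsupp.single_eq_of_ne (extendRoot_ne_oneVertex s).symm,
      smul_zero]

theorem insertOp_oneVertex (t : RTree) :
    insertOp t (Finsupp.single oneVertex 1) = Finsupp.single (extendRoot t) 1 := by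
  rw [← join_one, insertOp_join, mul_one, Derivation.map_one_eq_zero, add_zero, join_X]

theorem elimOp_oneVertex (t : RTree) : elimOp t (Finsupp.single oneVertex 1) = 0 := by
  rw [← join_one, elimOp_join, Derivation.map_one_eq_zero, map_zero]

theorem elimOp_extendRoot_apply (t s : RTree) :
    elimOp t (Finsupp.single (extendRoot s) 1) oneVertex = Finsupp.single s (1 : ℂ) t := by
  rw [← join_X, elimOp_join, elimDer_X, map_add, Finsupp.add_apply, join_toForest_oneVertex,
    add_zero, ← mul_one (C _), ← MvPolynomial.smul_eq_C_mul, map_smul, join_one,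
    Finsupp.smul_apply, Finsupp.single_eq_same, smul_eq_mul, mul_one]

theorem insertOp_apply_oneVertex (t s : RTree) :
    insertOp t (Finsupp.single s 1) oneVertex = 0 := by
  rw [insertOp_single_apply, RTree.numGrafts_eq_zero, Nat.cast_zero]
  have := s.numVertices_pos
  have := t.numVertices_pos
  rw [numVertices_oneVertex]
  omega

/-- Linear forms on operators that form a dual family to the operators of the generators: they
take the coefficient of the one-vertex tree in the image of the one-vertex tree (after removal of
`t` in the case of `D⁺_t`) or, in the case of `D⁻_t`, of the tree whose root has the single
child `t`. -/
noncomputable def dualForm : Generator → (Module.End ℂ TreeSpace →ₗ[ℂ] ℂ)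
  | Generator.plus t => Finsupp.lapply oneVertex ∘ₗ elimOp t ∘ₗ
      LinearMap.applyₗ (Finsupp.single oneVertex 1)
  | Generator.minus t => Finsupp.lapply oneVertex ∘ₗ
      LinearMap.applyₗ (Finsupp.single (extendRoot t) 1)
  | Generator.grading => Finsupp.lapply oneVertex ∘ₗ
      LinearMap.applyₗ (Finsupp.single oneVertex 1)

theorem dualForm_genOp (g g' : Generator) :
    dualForm g (genOp g') = Finsupp.single g' (1 : ℂ) g := by
  classical
  cases g <;> cases g' <;>
    simp [dualForm, genOp, insertOp_oneVertex, elimOp_oneVertex, elimOp_extendRoot_apply,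
      insertOp_apply_oneVertex, gradOp_single, numVertices_oneVertex, Finsupp.single_apply,
      (extendRoot_ne_oneVertex _).symm, @eq_comm RTree]

/-! ### The representation and a basis of the insertion-elimination Lie algebra -/

namespace InsElim

/-- The quotient map from the free Lie algebra. -/
noncomputable def proj : FreeLieAlgebra ℂ Generator →ₗ⁅ℂ⁆ InsElim where
  toFun x := LieSubmodule.Quotient.mk (N := Relator.ideal) x
  map_add' _ _ := rfl
  map_smul' _ _ := rfl
  map_lie' := rfl

theorem proj_of (g : Generator) : proj (FreeLieAlgebra.of ℂ g) = gen g := rfl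

theorem proj_surjective : Function.Surjective proj := Quotient.mk_surjective

theorem proj_eq_zero {x : FreeLieAlgebra ℂ Generator} (h : x ∈ Relator.ideal) : proj x = 0 :=
  (LieSubmodule.Quotient.mk_eq_zero Relator.ideal).2 h

/-- The representation on trees. -/
noncomputable def rep : InsElim →ₗ[ℂ] Module.End ℂ TreeSpace :=
  Relator.ideal.toSubmodule.liftQ freeRep.toLinearMap relator_ideal_le_ker

theorem rep_proj (x : FreeLieAlgebra ℂ Generator) : rep (proj x) = freeRep x := rfl

theorem rep_gen (g : Generator) : rep (gen g) = genOp g :=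
  FreeLieAlgebra.lift_of_apply _ _

theorem rep_lie (x y : InsElim) : rep ⁅x, y⁆ = rep x * rep y - rep y * rep x := by
  obtain ⟨x, rfl⟩ := proj_surjective x
  obtain ⟨y, rfl⟩ := proj_surjective y
  rw [← LieHom.map_lie, rep_proj, rep_proj, rep_proj, freeRep_lie]

theorem linearIndependent_gen : LinearIndependent ℂ gen := by
  refine linearIndependent_iff.2 fun c hc => Finsupp.ext fun g => ?_
  have h : ∀ c : Generator →₀ ℂ,
      dualForm g (rep (Finsupp.linearCombination ℂ gen c)) = c g := by
    intro c
    induction c using Finsupp.induction_linear with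
    | zero => simp
    | add c c' hc hc' => simp only [map_add, hc, hc', Finsupp.add_apply]
    | single g' a =>
      rw [Finsupp.linearCombination_single, map_smul, map_smul, rep_gen, dualForm_genOp,
        ← Finsupp.smul_apply, Finsupp.smul_single, smul_eq_mul, mul_one]
  rw [← h, hc, map_zero, map_zero, Finsupp.zero_apply]

theorem lie_Dplus_Dplus (t₁ t₂ : RTree) : ⁅Dplus t₁, Dplus t₂⁆ =
    ((t₂.graft t₁).map Dplus).sum - ((t₁.graft t₂).map Dplus).sum := by
  have h := proj_eq_zero (LieSubmodule.subset_lieSpan (R := ℂ) (s := Relator.all)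
    (Or.inl (Or.inl (Or.inl (Or.inl (Or.inl ⟨t₁, t₂, rfl⟩))))))
  have hs : ∀ m : Multiset RTree,
      proj (m.map fun t => FreeLieAlgebra.of ℂ (Generator.plus t)).sum = (m.map Dplus).sum :=
    fun m => map_multiset_sum_map proj.toLinearMap.toAddMonoidHom _ _
  rw [Relator.plusPlus, map_sub, map_sub, LieHom.map_lie, hs, hs] at h
  exact sub_eq_zero.1 h

theorem lie_Dminus_Dminus (t₁ t₂ : RTree) : ⁅Dminus t₁, Dminus t₂⁆ =
    ∑ t ∈ (t₁.graft t₂).toFinset, (RTree.numCuts t₁ t₂ t : ℂ) • Dminus t -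
      ∑ t ∈ (t₂.graft t₁).toFinset, (RTree.numCuts t₂ t₁ t : ℂ) • Dminus t := by
  have h := proj_eq_zero (LieSubmodule.subset_lieSpan (R := ℂ) (s := Relator.all)
    (Or.inl (Or.inl (Or.inl (Or.inl (Or.inr ⟨t₁, t₂, rfl⟩))))))
  simp only [Relator.minusMinus, map_sub, LieHom.map_lie, map_sum, map_smul] at h
  exact sub_eq_zero.1 h

theorem lie_Dminus_Dplus {t₁ t₂ : RTree} (hne : t₁ ≠ t₂) : ⁅Dminus t₁, Dplus t₂⁆ =
    ∑ t ∈ (t₂.cuts.map Prod.snd).toFinset, (RTree.numCuts t t₁ t₂ : ℂ) • Dplus t +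
      ∑ t ∈ (t₁.cuts.map Prod.snd).toFinset, (t.numGrafts t₂ t₁ : ℂ) • Dminus t := by
  have h := proj_eq_zero (LieSubmodule.subset_lieSpan (R := ℂ) (s := Relator.all)
    (Or.inl (Or.inl (Or.inl (Or.inr ⟨t₁, t₂, hne, rfl⟩)))))
  simp only [Relator.minusPlus, map_sub, map_add, LieHom.map_lie, map_sum, map_smul] at h
  exact sub_eq_zero.1 h

theorem lie_Dminus_Dplus_self (t : RTree) : ⁅Dminus t, Dplus t⁆ = d := by
  have h := proj_eq_zero (LieSubmodule.subset_lieSpan (R := ℂ) (s := Relator.all)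
    (Or.inl (Or.inl (Or.inr ⟨t, rfl⟩))))
  rw [Relator.minusPlusSame, map_sub, LieHom.map_lie] at h
  exact sub_eq_zero.1 h

theorem lie_d_Dminus (t : RTree) : ⁅d, Dminus t⁆ = (-(t.numVertices : ℂ)) • Dminus t := by
  have h := proj_eq_zero (LieSubmodule.subset_lieSpan (R := ℂ) (s := Relator.all)
    (Or.inl (Or.inr ⟨t, rfl⟩)))
  rw [Relator.gradingMinus, map_sub, LieHom.map_lie, map_smul] at h
  exact sub_eq_zero.1 h

theorem lie_d_Dplus (t : RTree) : ⁅d, Dplus t⁆ = (t.numVertices : ℂ) • Dplus t := by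
  have h := proj_eq_zero (LieSubmodule.subset_lieSpan (R := ℂ) (s := Relator.all)
    (Or.inr ⟨t, rfl⟩))
  rw [Relator.gradingPlus, map_sub, LieHom.map_lie, map_smul] at h
  exact sub_eq_zero.1 h

theorem toSubmodule_lieSpan_eq_span {S : Set InsElim}
    (h : ∀ x ∈ S, ∀ y ∈ S, ⁅x, y⁆ ∈ Submodule.span ℂ S) :
    (LieSubalgebra.lieSpan ℂ InsElim S).toSubmodule = Submodule.span ℂ S := by
  refine le_antisymm ?_ (Submodule.span_le.2 LieSubalgebra.subset_lieSpan)
  have hl : ∀ {x y : InsElim}, x ∈ Submodule.span ℂ S → y ∈ Submodule.span ℂ S →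
      ⁅x, y⁆ ∈ Submodule.span ℂ S := by
    intro x y hx hy
    induction hx, hy using Submodule.span_induction₂ with
    | mem_mem x y hx hy => exact h x hx y hy
    | zero_left y hy => rw [zero_lie]; exact Submodule.zero_mem _
    | zero_right x hx => rw [lie_zero]; exact Submodule.zero_mem _
    | add_left x y z _ _ _ h₁ h₂ => rw [add_lie]; exact Submodule.add_mem _ h₁ h₂
    | add_right x y z _ _ _ h₁ h₂ => rw [lie_add]; exact Submodule.add_mem _ h₁ h₂
    | smul_left c x y _ _ h => rw [smul_lie]; exact Submodule.smul_mem _ c h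
    | smul_right c x y _ _ h => rw [lie_smul]; exact Submodule.smul_mem _ c h
  let K : LieSubalgebra ℂ InsElim := { Submodule.span ℂ S with lie_mem' := hl }
  have hK : LieSubalgebra.lieSpan ℂ InsElim S ≤ K :=
    LieSubalgebra.lieSpan_le.2 fun x hx => Submodule.subset_span hx
  exact hK

theorem sum_Dplus_mem (m : Multiset RTree) :
    (m.map Dplus).sum ∈ Submodule.span ℂ (Set.range Dplus) :=
  multiset_sum_mem _ fun x hx => by
    obtain ⟨t, -, rfl⟩ := Multiset.mem_map.1 hx
    exact Submodule.subset_span ⟨t, rfl⟩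

theorem sum_smul_mem {ι : Type*} (m : Finset ι) (c : ι → ℂ) (v : ι → InsElim) :
    ∑ t ∈ m, c t • v t ∈ Submodule.span ℂ (Set.range v) :=
  Submodule.sum_mem _ fun t _ => Submodule.smul_mem _ _ (Submodule.subset_span ⟨t, rfl⟩)

theorem lie_Dplus_Dplus_mem (t₁ t₂ : RTree) :
    ⁅Dplus t₁, Dplus t₂⁆ ∈ Submodule.span ℂ (Set.range Dplus) := by
  rw [lie_Dplus_Dplus]
  exact Submodule.sub_mem _ (sum_Dplus_mem _) (sum_Dplus_mem _)

theorem lie_Dminus_Dminus_mem (t₁ t₂ : RTree) :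
    ⁅Dminus t₁, Dminus t₂⁆ ∈ Submodule.span ℂ (Set.range Dminus) := by
  rw [lie_Dminus_Dminus]
  exact Submodule.sub_mem _ (sum_smul_mem _ _ _) (sum_smul_mem _ _ _)

theorem nPlus_toSubmodule : nPlus.toSubmodule = Submodule.span ℂ (Set.range Dplus) := by
  refine toSubmodule_lieSpan_eq_span ?_
  rintro _ ⟨t₁, rfl⟩ _ ⟨t₂, rfl⟩
  exact lie_Dplus_Dplus_mem t₁ t₂

theorem nMinus_toSubmodule : nMinus.toSubmodule = Submodule.span ℂ (Set.range Dminus) := by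
  refine toSubmodule_lieSpan_eq_span ?_
  rintro _ ⟨t₁, rfl⟩ _ ⟨t₂, rfl⟩
  exact lie_Dminus_Dminus_mem t₁ t₂

theorem lie_gen_gen_mem (g g' : Generator) :
    ⁅gen g, gen g'⁆ ∈ Submodule.span ℂ (Set.range gen) := by
  have hp : Submodule.span ℂ (Set.range Dplus) ≤ Submodule.span ℂ (Set.range gen) :=
    Submodule.span_mono (Set.range_comp_subset_range Generator.plus gen)
  have hm : Submodule.span ℂ (Set.range Dminus) ≤ Submodule.span ℂ (Set.range gen) :=
    Submodule.span_mono (Set.range_comp_subset_range Generator.minus gen)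
  have hg : ∀ g, gen g ∈ Submodule.span ℂ (Set.range gen) :=
    fun g => Submodule.subset_span ⟨g, rfl⟩
  have hmp : ∀ t₁ t₂, ⁅Dminus t₁, Dplus t₂⁆ ∈ Submodule.span ℂ (Set.range gen) := by
    intro t₁ t₂
    by_cases h : t₁ = t₂
    · rw [h, lie_Dminus_Dplus_self]
      exact hg _
    · rw [lie_Dminus_Dplus h]
      exact Submodule.add_mem _ (hp (sum_smul_mem _ _ _)) (hm (sum_smul_mem _ _ _))
  have hd : ∀ g, ⁅d, gen g⁆ ∈ Submodule.span ℂ (Set.range gen) := by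
    rintro (t | t | _)
    · exact lie_d_Dplus t ▸ Submodule.smul_mem _ _ (hg _)
    · exact lie_d_Dminus t ▸ Submodule.smul_mem _ _ (hg _)
    · exact lie_self d ▸ Submodule.zero_mem _
  have swap : ∀ x y : InsElim, ⁅x, y⁆ ∈ Submodule.span ℂ (Set.range gen) →
      ⁅y, x⁆ ∈ Submodule.span ℂ (Set.range gen) := by
    intro x y h
    rw [← lie_skew]
    exact Submodule.neg_mem _ h
  rcases g with t | t | _
  · rcases g' with t' | t' | _
    · exact hp (lie_Dplus_Dplus_mem t t')
    · exact swap _ _ (hmp t' t)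
    · exact swap _ _ (hd _)
  · rcases g' with t' | t' | _
    · exact hmp t t'
    · exact hm (lie_Dminus_Dminus_mem t t')
    · exact swap _ _ (hd _)
  · exact hd g'

theorem lieSpan_range_gen : LieSubalgebra.lieSpan ℂ InsElim (Set.range gen) = ⊤ := by
  let f : FreeLieAlgebra ℂ Generator →ₗ⁅ℂ⁆ LieSubalgebra.lieSpan ℂ InsElim (Set.range gen) :=
    FreeLieAlgebra.lift ℂ fun g => ⟨gen g, LieSubalgebra.subset_lieSpan ⟨g, rfl⟩⟩
  have hf : (LieSubalgebra.lieSpan ℂ InsElim (Set.range gen)).incl.comp f = proj :=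
    FreeLieAlgebra.hom_ext fun g => by
      rw [LieHom.comp_apply, FreeLieAlgebra.lift_of_apply, proj_of]
      rfl
  refine eq_top_iff.2 fun x _ => ?_
  obtain ⟨y, rfl⟩ := proj_surjective x
  rw [← hf]
  exact (f y).2

theorem span_range_gen : Submodule.span ℂ (Set.range gen) = ⊤ := by
  rw [← toSubmodule_lieSpan_eq_span, lieSpan_range_gen, LieSubalgebra.top_toSubmodule]
  rintro _ ⟨g, rfl⟩ _ ⟨g', rfl⟩
  exact lie_gen_gen_mem g g'

/-- The generators are a basis. -/
noncomputable def basis : Module.Basis Generator ℂ InsElim :=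
  Module.Basis.mk linearIndependent_gen span_range_gen.ge

@[simp] theorem basis_apply (g : Generator) : basis g = gen g := Module.Basis.mk_apply _ _ _

theorem dualForm_rep (g : Generator) (x : InsElim) : dualForm g (rep x) = basis.repr x g := by
  have h : dualForm g ∘ₗ rep = basis.coord g := basis.ext fun g' => by
    rw [LinearMap.comp_apply, basis_apply, rep_gen, dualForm_genOp, ← basis_apply,
      Module.Basis.coord_apply, Module.Basis.repr_self]
  exact LinearMap.congr_fun h x

theorem rep_injective : Function.Injective rep := by
  refine (injective_iff_map_eq_zero rep).2 fun x hx => basis.repr.map_eq_zero_iff.1 ?_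
  ext g
  rw [← dualForm_rep, hx, map_zero, Finsupp.zero_apply]

/-! ### Triangular decomposition -/

theorem isInternal_triangular : DirectSum.IsInternal
    ![nPlus.toSubmodule, Submodule.span ℂ {d}, nMinus.toSubmodule] := by
  let S : Fin 3 → Set Generator :=
    ![Set.range Generator.plus, {Generator.grading}, Set.range Generator.minus]
  have hS : ![nPlus.toSubmodule, Submodule.span ℂ {d}, nMinus.toSubmodule] =
      fun i => Submodule.span ℂ (gen '' S i) := by
    funext i
    fin_cases i
    · change nPlus.toSubmodule = Submodule.span ℂ (gen '' Set.range Generator.plus)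
      rw [nPlus_toSubmodule, ← Set.range_comp]
      rfl
    · change Submodule.span ℂ {d} = Submodule.span ℂ (gen '' {Generator.grading})
      rw [Set.image_singleton]
      rfl
    · change nMinus.toSubmodule = Submodule.span ℂ (gen '' Set.range Generator.minus)
      rw [nMinus_toSubmodule, ← Set.range_comp]
      rfl
  have hdisj : ∀ i j, j ≠ i → Disjoint (S i) (S j) := by
    intro i j hij
    rw [Set.disjoint_left]
    fin_cases i <;> fin_cases j <;> simp [S] at hij ⊢
  rw [hS, DirectSum.isInternal_submodule_iff_iSupIndep_and_iSup_eq_top]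
  constructor
  · rw [iSupIndep_def]
    intro i
    simp only [← Submodule.span_iUnion, ← Set.image_iUnion]
    refine linearIndependent_gen.disjoint_span_image ?_
    simp only [Set.disjoint_iUnion_right]
    exact fun j hj => hdisj i j hj
  · rw [← Submodule.span_iUnion, ← Set.image_iUnion, ← span_range_gen, ← Set.image_univ]
    congr 2
    refine Set.eq_univ_of_forall fun g => Set.mem_iUnion.2 ?_
    rcases g with t | t | _
    · exact ⟨0, t, rfl⟩
    · exact ⟨2, t, rfl⟩
    · exact ⟨1, rfl⟩

/-! ### Simplicity -/

/-- The eigenvalue of `ad d` at a generator. -/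
noncomputable def weight : Generator → ℂ
  | Generator.plus t => t.numVertices
  | Generator.minus t => -t.numVertices
  | Generator.grading => 0

theorem lie_d_gen (g : Generator) : ⁅d, gen g⁆ = weight g • gen g := by
  rcases g with t | t | _
  · exact lie_d_Dplus t
  · exact lie_d_Dminus t
  · exact (lie_self d).trans (zero_smul ℂ _).symm

theorem basis_repr_lie_d (x : InsElim) (g : Generator) :
    basis.repr ⁅d, x⁆ g = weight g * basis.repr x g := by
  have h : basis.coord g ∘ₗ (LieAlgebra.ad ℂ InsElim d : InsElim →ₗ[ℂ] InsElim) =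
      weight g • basis.coord g := basis.ext fun g' => by
    rw [LinearMap.comp_apply, LieAlgebra.ad_apply, basis_apply, lie_d_gen, map_smul,
      LinearMap.smul_apply, ← basis_apply, Module.Basis.coord_apply, Module.Basis.repr_self]
    by_cases hg : g = g'
    · rw [hg]
    · rw [Finsupp.single_eq_of_ne hg, smul_zero, smul_zero]
  exact LinearMap.congr_fun h x

theorem numVertices_cast_ne_zero (t : RTree) : (t.numVertices : ℂ) ≠ 0 :=
  Nat.cast_ne_zero.2 t.numVertices_pos.ne'

theorem weight_eq_zero {g : Generator} (h : weight g = 0) : g = Generator.grading := by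
  rcases g with t | t | _
  · exact absurd h (numVertices_cast_ne_zero t)
  · exact absurd h (neg_ne_zero.2 (numVertices_cast_ne_zero t))
  · rfl

/-- For trees with the same number of vertices all terms of the bracket vanish. -/
theorem lie_Dminus_Dplus_eq_zero {t₁ t₂ : RTree} (hne : t₁ ≠ t₂)
    (h : t₁.numVertices = t₂.numVertices) : ⁅Dminus t₁, Dplus t₂⁆ = 0 := by
  rw [lie_Dminus_Dplus hne, Finset.sum_eq_zero, Finset.sum_eq_zero, add_zero]
  · intro t _
    have := t.numVertices_pos
    rw [RTree.numGrafts_eq_zero (by omega), Nat.cast_zero, zero_smul]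
  · intro t _
    have := t.numVertices_pos
    rw [RTree.numCuts_eq_zero (by omega), Nat.cast_zero, zero_smul]

/-- Exchanges `D⁺_t` and `D⁻_t`. -/
def opposite : Generator → Generator
  | Generator.plus t => Generator.minus t
  | Generator.minus t => Generator.plus t
  | Generator.grading => Generator.grading

theorem numVertices_add_cast_ne_zero (s t : RTree) :
    (s.numVertices : ℂ) ≠ -(t.numVertices : ℂ) := by
  intro h
  have h' : ((s.numVertices + t.numVertices : ℕ) : ℂ) = 0 := by
    rw [Nat.cast_add, h, neg_add_cancel]
  have := Nat.cast_eq_zero.1 h'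
  have := s.numVertices_pos
  omega

theorem lie_opposite_eq_zero {g g' : Generator} (hne : g ≠ g') (h : weight g = weight g') :
    ⁅gen (opposite g), gen g'⁆ = 0 := by
  rcases g with t | t | _ <;> rcases g' with t' | t' | _
  · exact lie_Dminus_Dplus_eq_zero (fun e => hne (e ▸ rfl)) (Nat.cast_injective h)
  · exact absurd h (numVertices_add_cast_ne_zero t t')
  · exact absurd h (numVertices_cast_ne_zero t)
  · exact absurd h.symm (numVertices_add_cast_ne_zero t' t)
  · rw [← lie_skew, neg_eq_zero]
    exact lie_Dminus_Dplus_eq_zero (fun e => hne (e ▸ rfl))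
      (Nat.cast_injective (neg_injective h)).symm
  · exact absurd h (neg_ne_zero.2 (numVertices_cast_ne_zero t))
  · exact absurd h.symm (numVertices_cast_ne_zero t')
  · exact absurd h.symm (neg_ne_zero.2 (numVertices_cast_ne_zero t'))
  · exact absurd rfl hne

/-- A homogeneous element is a multiple of `d`, or its bracket with the opposite of any generator
that occurs in it is a non-zero multiple of `d`. -/
theorem d_mem_of_homogeneous (I : LieIdeal ℂ InsElim) {x : InsElim} (hx : x ∈ I) {g : Generator}
    (hg : basis.repr x g ≠ 0) (h : ∀ g', basis.repr x g' ≠ 0 → weight g' = weight g) :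
    d ∈ I := by
  have hsum : x = (basis.repr x).sum fun g' a => a • gen g' := by
    conv_lhs => rw [← basis.linearCombination_repr x, Finsupp.linearCombination_apply]
    simp only [basis_apply]
  have hbr : ⁅gen (opposite g), x⁆ = basis.repr x g • ⁅gen (opposite g), gen g⁆ := by
    conv_lhs => rw [hsum, Finsupp.sum, lie_sum]
    rw [Finset.sum_eq_single g, lie_smul]
    · intro g' hg' hne
      rw [lie_smul, lie_opposite_eq_zero hne.symm (h g' (Finsupp.mem_support_iff.1 hg')).symm,
        smul_zero]
    · intro h'
      exact absurd (Finsupp.mem_support_iff.2 hg) h'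
  have hmem : ⁅gen (opposite g), gen g⁆ ∈ I := by
    have h₁ : ⁅gen (opposite g), x⁆ ∈ I := lie_mem_right ℂ InsElim I _ _ hx
    rw [hbr] at h₁
    exact (Submodule.smul_mem_iff I.toSubmodule hg).1 h₁
  rcases g with t | t | _
  · exact lie_Dminus_Dplus_self t ▸ hmem
  · have h₁ : ⁅Dplus t, Dminus t⁆ ∈ I := hmem
    rw [← lie_skew, lie_Dminus_Dplus_self] at h₁
    exact (Submodule.neg_mem_iff I.toSubmodule).1 h₁
  · have h₁ : x = basis.repr x Generator.grading • d := by
      conv_lhs => rw [hsum, Finsupp.sum]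
      rw [Finset.sum_eq_single Generator.grading]
      · rfl
      · intro g' hg' hne
        exact absurd (weight_eq_zero (h g' (Finsupp.mem_support_iff.1 hg'))) hne
      · intro h'
        exact absurd (Finsupp.mem_support_iff.2 hg) h'
    rw [h₁] at hx
    exact (Submodule.smul_mem_iff I.toSubmodule hg).1 hx

/-- If `x` is not homogeneous, subtracting a multiple of it from `⁅d, x⁆` leaves a non-zero
element in which fewer generators occur. -/
theorem d_mem_of_ne_zero (I : LieIdeal ℂ InsElim) (n : ℕ) {x : InsElim} (hx : x ∈ I)
    (hx₀ : x ≠ 0) (hn : (basis.repr x).support.card = n) : d ∈ I := by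
  induction n using Nat.strong_induction_on generalizing x with
  | _ n ih =>
    obtain ⟨g, hg⟩ := Finsupp.ne_iff.1 (basis.repr.map_ne_zero_iff.2 hx₀)
    rw [Finsupp.zero_apply] at hg
    set y := ⁅d, x⁆ - weight g • x with hy
    have hyI : y ∈ I := sub_mem (lie_mem_right ℂ InsElim I _ _ hx) (I.smul_mem _ hx)
    have hyr : ∀ g', basis.repr y g' = (weight g' - weight g) * basis.repr x g' := by
      intro g'
      rw [hy, map_sub, map_smul, Finsupp.sub_apply, Finsupp.smul_apply, basis_repr_lie_d,
        smul_eq_mul, sub_mul]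
    by_cases hy₀ : y = 0
    · refine d_mem_of_homogeneous I hx hg fun g' hg' => ?_
      have h := hyr g'
      rw [hy₀, map_zero, Finsupp.zero_apply] at h
      exact sub_eq_zero.1 ((mul_eq_zero.1 h.symm).resolve_right hg')
    · refine ih _ ?_ hyI hy₀ rfl
      rw [← hn]
      refine Finset.card_lt_card (Finset.ssubset_iff_of_subset ?_ |>.2 ⟨g, ?_, ?_⟩)
      · intro g' hg'
        rw [Finsupp.mem_support_iff, hyr] at hg'
        exact Finsupp.mem_support_iff.2 (right_ne_zero_of_mul hg')
      · exact Finsupp.mem_support_iff.2 hg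
      · rw [Finsupp.mem_support_iff, hyr, sub_self, zero_mul, not_not]

theorem isSimple : LieAlgebra.IsSimple ℂ InsElim where
  eq_bot_or_eq_top I := by
    refine or_iff_not_imp_left.2 fun hI => ?_
    obtain ⟨x, hx, hx₀⟩ := Submodule.exists_mem_ne_zero_of_ne_bot
      (mt (LieSubmodule.toSubmodule_eq_bot I).1 hI)
    have hd : d ∈ I := d_mem_of_ne_zero I _ hx hx₀ rfl
    have hg : ∀ g, gen g ∈ I := by
      intro g
      by_cases h : weight g = 0
      · rw [weight_eq_zero h]
        exact hd
      · have h₁ : ⁅d, gen g⁆ ∈ I := lie_mem_left ℂ InsElim I _ _ hd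
        rw [lie_d_gen] at h₁
        exact (Submodule.smul_mem_iff I.toSubmodule h).1 h₁
    rw [← LieSubmodule.toSubmodule_eq_top, eq_top_iff, ← span_range_gen, Submodule.span_le]
    rintro _ ⟨g, rfl⟩
    exact hg g
  non_abelian h := by
    have h₁ := lie_d_Dplus oneVertex
    rw [h.trivial, eq_comm] at h₁
    exact smul_ne_zero (numVertices_cast_ne_zero _)
      (linearIndependent_gen.ne_zero (Generator.plus oneVertex)) h₁

end InsElim

end InsertionElimination

open InsertionElimination in
theorem theorem3p1 :
    LieAlgebra.IsSimple ℂ InsElim ∧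
    LieSubalgebra.lieSpan ℂ InsElim
      (Set.range InsElim.Dplus ∪ Set.range InsElim.Dminus ∪ {InsElim.d}) = ⊤ ∧
    DirectSum.IsInternal
      ![InsElim.nPlus.toSubmodule, Submodule.span ℂ {InsElim.d}, InsElim.nMinus.toSubmodule] ∧
    ∃ ρ : InsElim →ₗ[ℂ] Module.End ℂ (RTree →₀ ℂ),
      (∀ x y : InsElim, ρ ⁅x, y⁆ = ρ x * ρ y - ρ y * ρ x) ∧
      Function.Injective ρ ∧
      (∀ t s : RTree, ρ (InsElim.Dplus t) (Finsupp.single s 1) =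
        ((s.graft t).map (fun u => Finsupp.single u (1 : ℂ))).sum) ∧
      (∀ t s : RTree, ρ (InsElim.Dminus t) (Finsupp.single s 1) =
        ((s.cuts.filter (fun e => e.1 = t)).map (fun e => Finsupp.single e.2 (1 : ℂ))).sum) ∧
      ∀ s : RTree, ρ InsElim.d (Finsupp.single s 1) =
        Finsupp.single s (s.numVertices : ℂ) := by
  refine ⟨InsElim.isSimple, ?_, InsElim.isInternal_triangular, InsElim.rep, InsElim.rep_lie,
    InsElim.rep_injective, fun t s => ?_, fun t s => ?_, fun s => ?_⟩
  · rw [← InsElim.lieSpan_range_gen]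
    congr 1
    ext x
    constructor
    · rintro ((⟨t, rfl⟩ | ⟨t, rfl⟩) | rfl)
      · exact ⟨Generator.plus t, rfl⟩
      · exact ⟨Generator.minus t, rfl⟩
      · exact ⟨Generator.grading, rfl⟩
    · rintro ⟨t | t | _, rfl⟩
      · exact Or.inl (Or.inl ⟨t, rfl⟩)
      · exact Or.inl (Or.inr ⟨t, rfl⟩)
      · exact Or.inr rfl
  · rw [InsElim.Dplus, InsElim.rep_gen]
    exact insertOp_single t s
  · rw [InsElim.Dminus, InsElim.rep_gen]
    exact elimOp_single t s
  · rw [InsElim.d, InsElim.rep_gen]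
    exact gradOp_single s
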